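/- Let $(C_n)_{n\ge 0}$ be a sequence of rational numbers satisfying $$4(n+4)C_{n+5}+8(n+2)C_{n+4}+(n+3)C_{n+3}+(4n+7)C_{n+2}+(5n+4)C_{n+1}+2nC_n=0\qquad\text{for all } n\ge 0,$$ and suppose that $6C_4+C_2+C_1\neq 0$. Then there are only finitely many primes $p$ such that all the terms $C_n$ ($n\ge 0$) are $p$-integers (that is, have denominator in lowest terms not divisible by $p$). Moreover, there exists a real number $a>1$ (which may depend on the sequence) such that, for all sufficiently large $n$, the product of the distinct primes dividing the least common denominator of $C_1,\ldots,C_n$ is $>a^n$. -/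

import Mathlib

/-- A sequence `C₀, C₁, C₂, …` of rational numbers is a solution of the linear recurrence
`4(n+4)C_{n+5} + 8(n+2)C_{n+4} + (n+3)C_{n+3} + (4n+7)C_{n+2} + (5n+4)C_{n+1} + 2nC_n = 0`,
for all `n ≥ 0`. The initial values `C₀, …, C₄` are arbitrary. -/
def IsRecurrenceSolution (C : ℕ → ℚ) : Prop :=
  ∀ n : ℕ,
    4 * ((n : ℚ) + 4) * C (n + 5) + 8 * ((n : ℚ) + 2) * C (n + 4) + ((n : ℚ) + 3) * C (n + 3)
      + (4 * (n : ℚ) + 7) * C (n + 2) + (5 * (n : ℚ) + 4) * C (n + 1) + 2 * (n : ℚ) * C n = 0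

/-- A rational number is a `p`-integer when `p` does not divide its denominator in lowest terms. -/
def IsPInteger (p : ℕ) (q : ℚ) : Prop :=
  ¬ p ∣ q.den

/-- The least common denominator of `C₁, …, Cₙ`. -/
def leastCommonDenominator (C : ℕ → ℚ) (n : ℕ) : ℕ :=
  (Finset.Icc 1 n).lcm fun i => (C i).den

/-- The product of the distinct primes dividing the least common denominator of `C₁, …, Cₙ`. -/
def denominatorRadical (C : ℕ → ℚ) (n : ℕ) : ℕ :=
  ∏ p ∈ (leastCommonDenominator C n).primeFactors, p

open Polynomial

/-! For y = ∑ C_n x^n, U = x(2x+1) and D = (x²+x)²+4, the recurrence says (y√D/U)' = R/(U²√D) with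
deg R ≤ 4. If the C_n are p-integers, reduce mod p and multiply by (U√D)^p, whose derivative is 0:
the polynomial R U^(p-2) D^((p-1)/2) becomes a derivative. Its "residue" at x = -1/2 must then
vanish, and this is 6C_4 + C_2 + C_1 up to a factor nonzero mod p
(`initial_relation_of_recurrence`). Only the terms up to 4p matter, so every large p ≤ n/4 divides
the common denominator of C_1, …, C_n; Chebyshev's lower bound for θ gives the exponential growth.
-/

theorem Polynomial.exists_derivative_eq {p : ℕ} [Fact p.Prime] (f : (ZMod p)[X])
    (h : ∀ n, p ∣ n + 1 → f.coeff n = 0) : ∃ g : (ZMod p)[X], derivative g = f := by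
  refine ⟨∑ n ∈ Finset.range (f.natDegree + 1), monomial (n + 1) (f.coeff n / ((n : ZMod p) + 1)),
    ?_⟩
  conv_rhs => rw [f.as_sum_range]
  rw [derivative_sum]
  refine Finset.sum_congr rfl fun n _ => ?_
  rw [derivative_monomial, Nat.add_sub_cancel]
  congr 1
  by_cases hn : p ∣ n + 1
  · simp [h n hn]
  · have : ((n : ZMod p) + 1) ≠ 0 := by
      rw [← ZMod.natCast_eq_zero_iff] at hn
      exact_mod_cast hn
    push_cast
    field_simp

theorem Polynomial.coeff_derivative_eq_zero_of_dvd {p : ℕ} [Fact p.Prime] (f : (ZMod p)[X]) {n : ℕ}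
    (h : p ∣ n + 1) : (derivative f).coeff n = 0 := by
  have : ((n : ZMod p) + 1) = 0 := by
    rw [← ZMod.natCast_eq_zero_iff] at h
    exact_mod_cast h
  rw [coeff_derivative, this, mul_zero]

theorem Polynomial.derivative_taylor' {R : Type*} [CommRing R] (r : R) (f : R[X]) :
    derivative (taylor r f) = taylor r (derivative f) := by
  simp [taylor_apply, derivative_comp]

/-- The part of degree at most `4` that remains when the differential operator attached to the
recurrence is applied to the generating function of a solution `c`. -/
noncomputable def initialPolynomial {K : Type*} [Field K] (c : ℕ → K) : K[X] :=
  C (-4 * c 0) + C (-16 * c 0) * X + C (4 * c 2 - 8 * c 1) * X ^ 2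
    + C (8 * c 3 + c 1 - c 0) * X ^ 3 + C (12 * c 4 + 8 * c 3 + 2 * c 2 + 3 * c 1 - c 0) * X ^ 4

/-! ### The differential equation and its residue modulo p -/

theorem coeff_operator_truncation {K : Type*} [Field K] (c : ℕ → K) {N : ℕ} (hN : 5 ≤ N)
    (hc : ∀ n : ℕ, n + 5 < N →
      4 * ((n : K) + 4) * c (n + 5) + 8 * ((n : K) + 2) * c (n + 4) + ((n : K) + 3) * c (n + 3)
      + (4 * (n : K) + 7) * c (n + 2) + (5 * (n : K) + 4) * c (n + 1) + 2 * (n : K) * c n = 0)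
    (F : K[X]) (hF : ∀ i < N, F.coeff i = c i) {m : ℕ} (hm : m < N) :
    (X * (2 * X + 1) * ((X ^ 2 + X) ^ 2 + 4) * derivative F
      - (4 + 16 * X + X ^ 3 + X ^ 4) * F - initialPolynomial c).coeff m = 0 := by
  have expand : X * (2 * X + 1) * ((X ^ 2 + X) ^ 2 + 4) * derivative F
      - (4 + 16 * X + X ^ 3 + X ^ 4) * F - initialPolynomial c =
      C 4 * (X ^ 1 * derivative F) + C 8 * (X ^ 2 * derivative F) + X ^ 3 * derivative F
      + C 4 * (X ^ 4 * derivative F) + C 5 * (X ^ 5 * derivative F) + C 2 * (X ^ 6 * derivative F)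
      - C 4 * (X ^ 0 * F) - C 16 * (X ^ 1 * F) - X ^ 3 * F - X ^ 4 * F - initialPolynomial c := by
    simp only [map_ofNat]
    ring
  rw [expand, initialPolynomial]
  simp only [coeff_add, coeff_sub, coeff_C_mul, coeff_X_pow_mul', coeff_derivative, coeff_C,
    coeff_X_pow, coeff_X]
  rcases lt_or_ge m 5 with h5 | h5
  · interval_cases m <;> simp [hF _ (show 0 < N by omega), hF _ (show 1 < N by omega),
      hF _ (show 2 < N by omega), hF _ (show 3 < N by omega), hF _ (show 4 < N by omega)] <;> ring
  · obtain ⟨n, rfl⟩ := Nat.exists_eq_add_of_le' h5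
    have h := hc n hm
    have e1 : n + 5 - 1 = n + 4 := by omega
    have e2 : n + 5 - 2 = n + 3 := by omega
    have e3 : n + 5 - 3 = n + 2 := by omega
    have e4 : n + 5 - 4 = n + 1 := by omega
    have e5 : n + 5 - 5 = n := by omega
    have l1 : 1 ≤ n + 5 := by omega
    have l2 : 2 ≤ n + 5 := by omega
    have l3 : 3 ≤ n + 5 := by omega
    have l4 : 4 ≤ n + 5 := by omega
    have n0 : n + 5 ≠ 0 := by omega
    have n1 : 1 ≠ n + 5 := by omega
    have n2 : n + 5 ≠ 2 := by omega
    have n3 : n + 5 ≠ 3 := by omega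
    have n4 : n + 5 ≠ 4 := by omega
    simp only [e1, e2, e3, e4, e5, l1, l2, l3, l4, h5, n0, n1, n2, n3, n4, if_true, if_false,
      Nat.zero_le, Nat.sub_zero]
    rw [hF (n + 5) hm, hF (n + 3 + 1) (by omega),
      hF (n + 2 + 1) (by omega), hF (n + 1 + 1) (by omega),
      hF (n + 1) (by omega)]
    have h6 : (if 6 ≤ n + 5 then F.coeff (n + 5 - 6 + 1) * (((n + 5 - 6 : ℕ) : K) + 1) else 0)
        = n * c n := by
      rcases n with _ | n
      · simp
      · rw [if_pos (by omega), show n + 1 + 5 - 6 = n by omega, hF (n + 1) (by omega)]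
        push_cast
        ring
    rw [h6]
    push_cast
    linear_combination h

theorem initial_relation_of_recurrence {p k : ℕ} [Fact p.Prime] (hpk : p = 2 * k + 3)
    (h65 : (65 : ZMod p) ≠ 0) (c : ℕ → ZMod p)
    (hc : ∀ n : ℕ, n + 5 < 4 * p →
      4 * ((n : ZMod p) + 4) * c (n + 5) + 8 * ((n : ZMod p) + 2) * c (n + 4)
      + ((n : ZMod p) + 3) * c (n + 3) + (4 * (n : ZMod p) + 7) * c (n + 2)
      + (5 * (n : ZMod p) + 4) * c (n + 1) + 2 * (n : ZMod p) * c n = 0) :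
    6 * c 4 + c 2 + c 1 = 0 := by
  have hp0 : (2 * (k : ZMod p) + 3) = 0 := by
    have := ZMod.natCast_self p
    have e : ((2 * k + 3 : ℕ) : ZMod p) = 0 := by rw [← hpk, this]
    exact_mod_cast e
  have h2 : (2 : ZMod p) ≠ 0 := by
    intro h
    have := (ZMod.natCast_eq_zero_iff 2 p).1 (by exact_mod_cast h)
    have := Nat.le_of_dvd (by norm_num) this
    omega
  set R := initialPolynomial c with hR
  set D : (ZMod p)[X] := (X ^ 2 + X) ^ 2 + 4 with hD
  set F : (ZMod p)[X] := ∑ i ∈ Finset.range (4 * p), monomial i (c i) with hFdef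
  have hF : ∀ i < 4 * p, F.coeff i = c i := by
    intro i hi
    rw [hFdef, finsetSum_coeff, Finset.sum_eq_single i]
    · simp
    · intro j _ hj
      simp [coeff_monomial, hj]
    · simp [hi]
  set T := X * (2 * X + 1) * D * derivative F - (4 + 16 * X + X ^ 3 + X ^ 4) * F - R with hT
  have hTdvd : X ^ (4 * p) ∣ T := X_pow_dvd_iff.2 fun m hm =>
    coeff_operator_truncation c (by omega) hc F hF hm
  have hkpoly : (2 * (k : (ZMod p)[X]) + 3) = 0 := by
    have := congrArg (C : ZMod p → (ZMod p)[X]) hp0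
    simpa only [map_add, map_mul, map_ofNat, map_natCast, map_zero] using this
  set W : (ZMod p)[X] := (X * (2 * X + 1)) ^ (2 * k + 1) * D ^ (k + 1) with hW
  -- The exponents are p - 1 ≡ -1 and (p+1)/2 ≡ 1/2: a polynomial stand-in for the integrating
  -- factor √D/U.
  have hder : derivative (F * ((X * (2 * X + 1)) ^ (2 * k + 2) * D ^ (k + 2))) = T * W + R * W := by
    have hD' : derivative D = 2 * (X ^ 2 + X) * (2 * X + 1) := by
      simp only [hD, derivative_pow, derivative_add, derivative_X, derivative_ofNat,
        Nat.cast_ofNat, map_ofNat]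
      ring
    have hU' : derivative (X * (2 * X + 1) : (ZMod p)[X]) = 4 * X + 1 := by
      simp only [derivative_mul, derivative_add, derivative_X, derivative_ofNat, derivative_one]
      ring
    rw [hT, hW, derivative_mul, derivative_mul, derivative_pow, derivative_pow, hD', hU',
      show 2 * k + 2 - 1 = 2 * k + 1 by omega, show k + 2 - 1 = k + 1 by omega,
      pow_succ _ (2 * k + 1), pow_succ _ (k + 1)]
    simp only [Nat.cast_add, Nat.cast_mul, Nat.cast_ofNat, map_add, map_mul, map_ofNat,
      map_natCast]
    generalize (X * (2 * X + 1) : (ZMod p)[X]) ^ (2 * k + 1) = a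
    generalize D ^ (k + 1) = b
    rw [hD]
    linear_combination (F * a * b * ((4 * X + 1) * ((X ^ 2 + X) ^ 2 + 4)
      + X * (2 * X + 1) * (X ^ 2 + X) * (2 * X + 1))) * hkpoly
  -- This bound dictates the cutoff 4p: the error `T * W` starts at X^(4p), and `R * W` has no
  -- coefficient at 4p - 1 or beyond.
  have hdeg : (R * W).natDegree ≤ 4 * p - 2 := by
    have h1 : R.natDegree ≤ 4 := by rw [hR, initialPolynomial]; compute_degree
    have h2 : D.natDegree ≤ 4 := by rw [hD]; compute_degree
    have h3 : (X * (2 * X + 1) : (ZMod p)[X]).natDegree ≤ 2 := by compute_degree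
    have h4 := natDegree_pow_le_of_le (2 * k + 1) h3
    have h5 := natDegree_pow_le_of_le (k + 1) h2
    have h6 := natDegree_mul_le_of_le h1 (natDegree_mul_le_of_le h4 h5)
    rw [← hW] at h6
    omega
  obtain ⟨E, hE⟩ := Polynomial.exists_derivative_eq (R * W) (by
    intro n hn
    rcases lt_or_ge n (4 * p - 1) with h | h
    · have h0 := Polynomial.coeff_derivative_eq_zero_of_dvd
        (F * ((X * (2 * X + 1)) ^ (2 * k + 2) * D ^ (k + 2))) hn
      rw [hder, coeff_add, X_pow_dvd_iff.1 (hTdvd.mul_right W) n (by omega), zero_add] at h0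
      exact h0
    · exact coeff_eq_zero_of_natDegree_lt (by omega))
  obtain ⟨s, hs⟩ : ∃ s : ZMod p, 2 * s + 1 = 0 := ⟨-1 / 2, by field_simp; ring⟩
  set M : (ZMod p)[X] := R * (X ^ (2 * k + 1) * D ^ (k + 1)) with hM
  -- Expanded at s = -1/2, the derivative of E has no term of degree p - 1, and `R * W` is M times
  -- (2X+1)^(p-2).
  have hM' : (derivative M).eval s = 0 := by
    have h0 := Polynomial.coeff_derivative_eq_zero_of_dvd (taylor s E) (n := 2 * k + 2)
      (by rw [hpk])
    have hRW : R * W = M * (2 * X + 1) ^ (2 * k + 1) := by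
      rw [hW, hM, mul_pow]
      ring
    have hlin : taylor s (2 * X + 1 : (ZMod p)[X]) = C 2 * X := by
      have := congrArg (C : ZMod p → (ZMod p)[X]) hs
      simp only [map_add, map_mul, map_one, map_zero] at this
      simp only [taylor_apply, add_comp, mul_comp, X_comp, one_comp, ofNat_comp]
      simp only [map_ofNat] at this ⊢
      linear_combination this
    rw [Polynomial.derivative_taylor', hE, hRW, taylor_mul, taylor_pow, hlin, mul_pow, ← C_pow,
      mul_left_comm, coeff_C_mul, show 2 * k + 2 = 1 + (2 * k + 1) by ring, coeff_mul_X_pow,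
      taylor_coeff_one] at h0
    exact (mul_eq_zero.1 h0).resolve_left (pow_ne_zero _ h2)
  have hs' : s = -1 / 2 := by
    field_simp
    linear_combination hs
  have hs0 : s ≠ 0 := by
    rintro rfl
    simp at hs
  -- D(-1/2) = 65/16.
  have hDs : D.eval s ≠ 0 := by
    intro h
    apply h65
    simp only [hD, eval_add, eval_pow, eval_X, eval_ofNat, hs'] at h
    field_simp at h
    linear_combination h
  have hD's : (derivative D).eval s = 0 := by
    simp only [hD, derivative_pow, derivative_add, derivative_X, derivative_ofNat, eval_mul,
      eval_add, eval_pow, eval_X, eval_C, eval_one, eval_zero]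
    push_cast
    linear_combination 2 * (s ^ 2 + s) * hs
  have hprod : s ^ (2 * k) * D.eval s ^ (k + 1) *
      ((derivative R).eval s * s - 2 * R.eval s) = 0 := by
    rw [← hM', hM]
    simp only [derivative_mul, derivative_pow, derivative_X, eval_mul, eval_add, eval_pow, eval_X,
      eval_C, eval_one, hD's, Nat.add_sub_cancel]
    push_cast
    linear_combination (-s ^ (2 * k) * D.eval s ^ (k + 1) * R.eval s) * hp0
  have hfin := (mul_eq_zero.1 hprod).resolve_left
    (mul_ne_zero (pow_ne_zero _ hs0) (pow_ne_zero _ hDs))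
  simp only [hR, initialPolynomial, derivative_add, derivative_mul, derivative_C, derivative_X_pow,
    derivative_X, eval_add, eval_mul, eval_C, eval_pow, eval_X, eval_one, eval_zero] at hfin
  push_cast at hfin
  rw [hs'] at hfin
  field_simp at hfin
  refine (mul_eq_zero.1 (?_ : 2 ^ 3 * (6 * c 4 + c 2 + c 1) = 0)).resolve_left (pow_ne_zero _ h2)
  linear_combination hfin

/-! ### Large primes divide the common denominator -/

theorem dvd_leastCommonDenominator (C : ℕ → ℚ) {i n : ℕ} (h1 : 1 ≤ i) (hn : i ≤ n) :
    (C i).den ∣ leastCommonDenominator C n :=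
  Finset.dvd_lcm (f := fun i => (C i).den) (Finset.mem_Icc.2 ⟨h1, hn⟩)

theorem leastCommonDenominator_ne_zero (C : ℕ → ℚ) (n : ℕ) : leastCommonDenominator C n ≠ 0 := by
  rw [leastCommonDenominator, Ne, Finset.lcm_eq_zero_iff]
  simp

theorem exists_dvd_den_of_dvd_leastCommonDenominator {C : ℕ → ℚ} {p n : ℕ} (hp : p.Prime)
    (h : p ∣ leastCommonDenominator C n) : ∃ i, p ∣ (C i).den := by
  have h1 : leastCommonDenominator C n ∣ ∏ i ∈ Finset.Icc 1 n, (C i).den :=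
    Finset.lcm_dvd fun i hi => Finset.dvd_prod_of_mem _ hi
  obtain ⟨i, -, hi⟩ := (hp.prime.dvd_finsetProd_iff _).1 (h.trans h1)
  exact ⟨i, hi⟩

theorem Rat.exists_int_eq_natCast_mul {q : ℚ} {D : ℕ} (h : q.den ∣ D) :
    ∃ a : ℤ, (a : ℚ) = D * q := by
  obtain ⟨e, rfl⟩ := h
  refine ⟨e * q.num, ?_⟩
  have := Rat.den_mul_eq_num q
  push_cast
  linear_combination (-(e : ℚ)) * this

theorem prime_dvd_leastCommonDenominator {C : ℕ → ℚ} (hC : IsRecurrenceSolution C)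
    {p n : ℕ} (hp : p.Prime) (h65 : 65 < p) (h0 : (C 0).den < p)
    (hnum : (6 * C 4 + C 2 + C 1).num.natAbs < p) (hne : 6 * C 4 + C 2 + C 1 ≠ 0)
    (hn : 4 * p ≤ n) : p ∣ leastCommonDenominator C n := by
  by_contra hdvd
  have : Fact p.Prime := ⟨hp⟩
  -- The common denominator starts at C_1, so C_0 is cleared separately.
  set D := (C 0).den * leastCommonDenominator C n with hD
  have hpD : ¬ p ∣ D := by
    rw [hD, hp.dvd_mul, not_or]
    exact ⟨Nat.not_dvd_of_pos_of_lt (C 0).pos h0, hdvd⟩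
  have hA : ∀ i, ∃ a : ℤ, i ≤ n → (a : ℚ) = D * C i := by
    intro i
    by_cases hi : i ≤ n
    · obtain ⟨a, ha⟩ := Rat.exists_int_eq_natCast_mul (q := C i) (D := D) (by
        rcases Nat.eq_zero_or_pos i with rfl | hi0
        · exact Dvd.intro _ rfl
        · exact (dvd_leastCommonDenominator C hi0 hi).mul_left _)
      exact ⟨a, fun _ => ha⟩
    · exact ⟨0, fun h => absurd h hi⟩
  choose A hA using hA
  obtain ⟨k, hk⟩ : ∃ k, p = 2 * k + 3 := by
    obtain ⟨j, hj⟩ := hp.odd_of_ne_two (by omega)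
    exact ⟨j - 1, by omega⟩
  have key := initial_relation_of_recurrence hk (by
      intro h
      have := (ZMod.natCast_eq_zero_iff 65 p).1 (by exact_mod_cast h)
      exact absurd (Nat.le_of_dvd (by norm_num) this) (by omega))
    (fun i => (A i : ZMod p)) (by
      intro m hm
      have hZ : 4 * ((m : ℤ) + 4) * A (m + 5) + 8 * ((m : ℤ) + 2) * A (m + 4)
          + ((m : ℤ) + 3) * A (m + 3) + (4 * (m : ℤ) + 7) * A (m + 2)
          + (5 * (m : ℤ) + 4) * A (m + 1) + 2 * (m : ℤ) * A m = 0 := by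
        have : ((4 * ((m : ℤ) + 4) * A (m + 5) + 8 * ((m : ℤ) + 2) * A (m + 4)
          + ((m : ℤ) + 3) * A (m + 3) + (4 * (m : ℤ) + 7) * A (m + 2)
          + (5 * (m : ℤ) + 4) * A (m + 1) + 2 * (m : ℤ) * A m : ℤ) : ℚ) = 0 := by
          push_cast
          rw [hA (m + 5) (by omega), hA (m + 4) (by omega), hA (m + 3) (by omega),
            hA (m + 2) (by omega), hA (m + 1) (by omega), hA m (by omega)]
          linear_combination (D : ℚ) * hC m
        exact_mod_cast this
      have := congrArg (Int.cast : ℤ → ZMod p) hZ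
      push_cast at this
      exact this)
  have hdvd' : (p : ℤ) ∣ 6 * A 4 + A 2 + A 1 := by
    rw [← ZMod.intCast_zmod_eq_zero_iff_dvd]
    push_cast
    exact key
  set q := 6 * C 4 + C 2 + C 1 with hq
  have hrel : (q.den : ℤ) * (6 * A 4 + A 2 + A 1) = D * q.num := by
    have : ((q.den * (6 * A 4 + A 2 + A 1) : ℤ) : ℚ) = ((D * q.num : ℤ) : ℚ) := by
      push_cast
      rw [hA 4 (by omega), hA 2 (by omega), hA 1 (by omega), ← Rat.den_mul_eq_num q]
      linear_combination (-(D : ℚ) * q.den) * hq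
    exact_mod_cast this
  have h1 : (p : ℤ) ∣ D * q.num := hrel ▸ hdvd'.mul_left _
  rcases (Nat.prime_iff_prime_int.1 hp).dvd_or_dvd h1 with h | h
  · exact hpD (by exact_mod_cast h)
  · rw [Int.natCast_dvd] at h
    refine Nat.not_dvd_of_pos_of_lt (Int.natAbs_pos.2 (Rat.num_ne_zero.2 hne)) hnum h

/-! ### Exponential growth of the radical -/

theorem eventually_mul_lt_theta {c : ℝ} (hc : c < Real.log 2) (b : ℝ) :
    ∀ᶠ k : ℕ in Filter.atTop, c * k + b < Chebyshev.theta k := by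
  have hlog := Real.isLittleO_log_id_atTop
  have hsqrt : (fun x : ℝ => √x * Real.log x) =o[Filter.atTop] (fun x : ℝ => x) := by
    have h1 : Real.log =o[Filter.atTop] fun x : ℝ => √x := by
      simpa only [Real.sqrt_eq_rpow] using isLittleO_log_rpow_atTop (r := 1 / 2) (by norm_num)
    refine ((Asymptotics.isBigO_refl (fun x : ℝ => √x) Filter.atTop).mul_isLittleO h1).congr'
      Filter.EventuallyEq.rfl ?_
    filter_upwards [Filter.eventually_ge_atTop 0] with x hx using Real.mul_self_sqrt hx
  set ε := (Real.log 2 - c) / 8 with hε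
  have hε0 : 0 < ε := by rw [hε]; linarith
  have e1 := hlog.bound hε0
  have e2 := hsqrt.bound hε0
  have t1 : Filter.Tendsto (fun k : ℕ => (k : ℝ) + 1) Filter.atTop Filter.atTop :=
    Filter.tendsto_atTop_add_const_right _ _ tendsto_natCast_atTop_atTop
  filter_upwards [t1.eventually e1, tendsto_natCast_atTop_atTop.eventually e2,
    tendsto_natCast_atTop_atTop.eventually (Filter.eventually_gt_atTop ((|b| + ε) / ε))]
    with k h1 h2 h3
  have hk : (0 : ℝ) ≤ k := Nat.cast_nonneg k
  have h1' := (le_abs_self _).trans h1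
  have h2' := (le_abs_self _).trans h2
  simp only [id, Real.norm_eq_abs, abs_of_nonneg hk, abs_of_nonneg (by linarith : (0:ℝ) ≤ k + 1)]
    at h1' h2'
  rw [div_lt_iff₀ hε0] at h3
  have h4 := Chebyshev.theta_ge k
  have h5 := le_abs_self b
  have h6 : Real.log 2 = c + 8 * ε := by rw [hε]; ring
  rw [h6] at h4
  nlinarith [mul_nonneg hk hε0.le]

theorem primorial_le_mul_of_forall_dvd {B k m : ℕ} (hm : m ≠ 0)
    (h : ∀ p, p.Prime → B < p → p ≤ k → p ∣ m) :
    primorial k ≤ primorial B * ∏ p ∈ m.primeFactors, p := by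
  rw [primorial_eq_prod_primesLE, primorial_eq_prod_primesLE, ← Finset.prod_union_inter]
  have hsub : Nat.primesLE k ⊆ Nat.primesLE B ∪ m.primeFactors := by
    intro p hp
    rw [Nat.mem_primesLE] at hp
    rw [Finset.mem_union, Nat.mem_primesLE, Nat.mem_primeFactors]
    by_cases hB : p ≤ B
    · exact Or.inl ⟨hB, hp.2⟩
    · exact Or.inr ⟨hp.2, h p hp.2 (by omega) hp.1, hm⟩
  have hone : ∀ p ∈ Nat.primesLE B ∪ m.primeFactors, 1 ≤ p := by
    intro p hp
    rw [Finset.mem_union, Nat.mem_primesLE, Nat.mem_primeFactors] at hp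
    rcases hp with hp | hp
    · exact hp.2.one_lt.le
    · exact hp.1.one_lt.le
  refine (Finset.prod_le_prod_of_subset_of_one_le' hsub fun p hp _ => hone p hp).trans
    (Nat.le_mul_of_pos_right _ (Finset.prod_pos fun p hp => ?_))
  exact hone p (Finset.mem_union_left _ (Finset.mem_inter.1 hp).1)

theorem corollary5 (C : ℕ → ℚ) (hC : IsRecurrenceSolution C)
    (hne : 6 * C 4 + C 2 + C 1 ≠ 0) :
    {p : ℕ | p.Prime ∧ ∀ n : ℕ, IsPInteger p (C n)}.Finite ∧
      ∃ a : ℝ, 1 < a ∧ ∃ N : ℕ, ∀ n : ℕ, N ≤ n → a ^ n < (denominatorRadical C n : ℝ) := by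
  obtain ⟨B, hB⟩ : ∃ B, ∀ p n : ℕ, p.Prime → B < p → 4 * p ≤ n →
      p ∣ leastCommonDenominator C n :=
    ⟨65 + (C 0).den + (6 * C 4 + C 2 + C 1).num.natAbs, fun p n hp hBp hn =>
      prime_dvd_leastCommonDenominator hC hp (by omega) (by omega) (by omega) hne hn⟩
  constructor
  · refine (Set.finite_Iic B).subset fun p hp => ?_
    by_contra hpB
    obtain ⟨i, hi⟩ := exists_dvd_den_of_dvd_leastCommonDenominator hp.1
      (hB p (4 * p) hp.1 (not_le.1 hpB) le_rfl)
    exact hp.2 i hi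
  · have hl2 : 0 < Real.log 2 := Real.log_pos one_lt_two
    refine ⟨Real.exp (Real.log 2 / 8), Real.one_lt_exp_iff.2 (by positivity), ?_⟩
    -- The rate log 2 / 2 at ⌊n/4⌋ yields log 2 / 8 per n; the extra log 2 absorbs the rounding loss
    -- of at most 3 log 2 / 8.
    obtain ⟨K, hK⟩ := Filter.eventually_atTop.1 (eventually_mul_lt_theta
      (c := Real.log 2 / 2) (by linarith) (Real.log 2 + Real.log (primorial B)))
    refine ⟨4 * K, fun n hn => ?_⟩
    have h1 := hK (n / 4) (by omega)
    rw [Chebyshev.theta_eq_log_primorial, Nat.floor_natCast] at h1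
    have hle : primorial (n / 4) ≤ primorial B * denominatorRadical C n :=
      primorial_le_mul_of_forall_dvd (leastCommonDenominator_ne_zero C n)
        fun p hp hBp hpn => hB p n hp hBp (by omega)
    have hrad : (0 : ℝ) < denominatorRadical C n := by
      rw [Nat.cast_pos]
      exact Finset.prod_pos fun p hp => (Nat.prime_of_mem_primeFactors hp).pos
    have hBpos : (0 : ℝ) < primorial B := Nat.cast_pos.2 (primorial_pos B)
    have h2 : Real.log (primorial (n / 4)) ≤
        Real.log (primorial B) + Real.log (denominatorRadical C n) := by
      rw [← Real.log_mul hBpos.ne' hrad.ne']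
      exact Real.log_le_log (Nat.cast_pos.2 (primorial_pos _)) (by exact_mod_cast hle)
    have h3 : (n : ℝ) ≤ 4 * (n / 4 : ℕ) + 3 := by
      exact_mod_cast (by omega : n ≤ 4 * (n / 4) + 3)
    rw [← Real.exp_nat_mul, ← Real.lt_log_iff_exp_lt hrad]
    nlinarith
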